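/- **Setting.** Floating-point arithmetic is modelled by a rounding function $\mathrm{fl}:\mathbf R\to\mathbf R$ with unit round-off $\mathbf u\in(0,1)$: for every real $x$ there are $\delta_1,\delta_2$ with $|\delta_1|,|\delta_2|\le\mathbf u$ and $\mathrm{fl}(x)=x(1+\delta_1)=x/(1+\delta_2)$. Write $a\oplus b=\mathrm{fl}(a+b)$, $a\otimes b=\mathrm{fl}(ab)$. The error-free transformations return the computed value and the exact round-off error: $\mathtt{TwoSum}(a,b)=[a\oplus b,\ a+b-(a\oplus b)]$, $\mathtt{TwoProd}(a,b)=[a\otimes b,\ ab-(a\otimes b)]$. Put $\gamma_m=m\mathbf u/(1-m\mathbf u)$ and $B_{j,k}(s)=\binom kj(1-s)^{k-j}s^j$. Let $b_0,\dots,b_n\in\mathbf R$, $s\in[0,1]$, $\widetilde p(s)=\sum_{j=0}^n|b_j|B_{j,n}(s)$ and $[\widehat r,\rho]=\mathtt{TwoSum}(1,-s)$. The $K$-compensated de Casteljau algorithm computes numbers $\widehat{\partial^Fb}{}_j^{(k)}$ ($F\ge0$, $0\le j\le k\le n$; $F=0$ is written $\widehat b_j^{(k)}$) as follows. Initially $\widehat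 b_j^{(n)}=b_j$ and $\widehat{\partial^Fb}{}_j^{(n)}=0$ for $F\ge1$. For $k=n-1,\dots,0$ and $0\le j\le k$: * $[P_1,e_1]=\mathtt{TwoProd}(\widehat r,\widehat b_j^{(k+1)})$, $[P_2,e_2]=\mathtt{TwoProd}(s,\widehat b_{j+1}^{(k+1)})$, $[\widehat b_j^{(k)},e_3]=\mathtt{TwoSum}(P_1,P_2)$. These are the terms $e_1,e_2,e_3$ of stage $1$. * For $F\ge1$, with $e_1,\dots,e_{5F-2}$ the terms of stage $F$, compute from left to right $$\widehat\ell=e_1\oplus e_2\oplus\cdots\oplus e_{5F-2}\oplus\bigl(\rho\otimes\widehat{\partial^{F-1}b}{}_j^{(k+1)}\bigr),\qquad \widehat{\partial^Fb}{}_j^{(k)}=\widehat\ell\oplus\bigl(s\otimes\widehat{\partial^Fb}{}_{j+1}^{(k+1)}\bigr)\oplus\bigl(\widehat r\otimes\widehat{\partial^Fb}{}_j^{(k+1)}\bigr),$$ every operation being carried out by $\mathtt{TwoSum}$ or $\mathtt{TwoProd}$. The $5F+3=5(F+1)-2$ round-off errors so obtained are the terms of stage $F+1$. For $F\ge1$ and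 $0\le j\le k<n$ let $\widetilde\ell_{F,j}^{(k)}=|e_1|+\cdots+|e_{5F-2}|+\bigl|\rho\cdot\widehat{\partial^{F-1}b}{}_j^{(k+1)}\bigr|$, with the terms of stage $F$ at $(k,j)$, and let $L_{F,k}=\sum_{j=0}^k\widetilde\ell_{F,j}^{(k)}B_{j,k}(s)$. **Lemma.** Let $F\ge1$. 1. There is a constant $A$ depending only on $F$, and for every $k\ge1$ there are $C$ and $u_0>0$ depending only on $F,k$, such that whenever $\mathbf u\le u_0$ and $n\ge k$, for all $\mathrm{fl}$, $b$ and $s\in[0,1]$, $$L_{F,n-k}\le\Bigl[\Bigl(3^F\tbinom k{F-1}+A\,k^{F-2}\Bigr)\mathbf u^F+C\,\mathbf u^{F+1}\Bigr]\widetilde p(s),$$ that is, $L_{F,n-k}\le\bigl[(3^F\binom k{F-1}+O(k^{F-2}))\mathbf u^F+O(\mathbf u^{F+1})\bigr]\widetilde p(s)$. 2. There is a constant $A$ depending only on $F$, and for every $n\ge0$ there are $C$ and $u_0>0$ depending only on $F,n$, such that whenever $\mathbf u\le u_0$, for all $\mathrm{fl}$, $b$ and $s\in[0,1]$, $$\sum_{k=0}^{n-1}\gamma_{3k+5F}L_{F,k}\le\Bigl[\Bigl(3^{F+1}\tbinom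 n{F+1}+A\,n^F\Bigr)\mathbf u^{F+1}+C\,\mathbf u^{F+2}\Bigr]\widetilde p(s).$$ 3. There are $C$ and $\delta>0$ depending only on $F$ such that whenever $3n\mathbf u\le\delta$, for all $\mathrm{fl}$, $n$, $b$ and $s\in[0,1]$, $$\Bigl|\sum_{k=0}^{n-1}\gamma_{3k+5F}L_{F,k}\Bigr|\le C\,(3n\mathbf u)^{F+1}\,\widetilde p(s),$$ that is, the sum is $O((3n\mathbf u)^{F+1})\cdot\widetilde p(s)$. -/

import Mathlib

namespace CompDC

/-- The standard model of floating point arithmetic with unit round-off `u`: every operation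
`∘ ∈ {+, -, ×, ÷}` is computed as `fl (a ∘ b)`, where rounding obeys
`fl x = x (1 + δ₁) = x / (1 + δ₂)` with `|δ₁|, |δ₂| ≤ u`. -/
structure IsRounding (u : ℝ) (fl : ℝ → ℝ) : Prop where
  pos : 0 < u
  lt_one : u < 1
  exists_mul : ∀ x : ℝ, ∃ δ : ℝ, |δ| ≤ u ∧ fl x = x * (1 + δ)
  exists_div : ∀ x : ℝ, ∃ δ : ℝ, |δ| ≤ u ∧ fl x = x / (1 + δ)

/-- `γ_m = m u / (1 - m u)`. -/
noncomputable def gamma (u : ℝ) (m : ℕ) : ℝ := m * u / (1 - m * u)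

/-- Error-free transformation of a sum: the computed sum and its round-off error. -/
noncomputable def twoSum (fl : ℝ → ℝ) (a b : ℝ) : ℝ × ℝ := (fl (a + b), a + b - fl (a + b))

/-- Error-free transformation of a product: the computed product and its round-off error. -/
noncomputable def twoProd (fl : ℝ → ℝ) (a b : ℝ) : ℝ × ℝ := (fl (a * b), a * b - fl (a * b))

/-- Left-to-right accumulation by `twoSum`, starting from `acc`: the computed sum and the list of
round-off errors, in the order in which they occur. -/
noncomputable def sumEFT (fl : ℝ → ℝ) : ℝ → List ℝ → ℝ × List ℝ
  | acc, [] => (acc, [])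
  | acc, x :: xs =>
    let t := twoSum fl acc x
    let r := sumEFT fl t.1 xs
    (r.1, t.2 :: r.2)

/-- `LocalErrorEFT(e, ρ, δb)`: computes `e₁ ⊕ e₂ ⊕ ⋯ ⊕ e_L ⊕ (ρ ⊗ δb)`, evaluated from left to
right, and returns the list `η₁, …, η_{L+1}` of round-off errors together with the computed value.
It is only used on non-empty lists `e`. -/
noncomputable def localErrorEFT (fl : ℝ → ℝ) (e : List ℝ) (ρ δb : ℝ) : List ℝ × ℝ :=
  let t := sumEFT fl (e.headD 0) e.tail
  let p := twoProd fl ρ δb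
  let l := twoSum fl t.1 p.1
  (t.2 ++ [p.2, l.2], l.1)

/-- `r̂ = 1 ⊖ s`. -/
noncomputable def rHat (fl : ℝ → ℝ) (s : ℝ) : ℝ := (twoSum fl 1 (-s)).1

/-- `ρ`, the round-off error of `1 ⊖ s`. -/
noncomputable def rho (fl : ℝ → ℝ) (s : ℝ) : ℝ := (twoSum fl 1 (-s)).2

/-- One inner step of the `K`-compensated de Casteljau algorithm, at a node `(k, j)`.
The input `x F` is the already computed `∂̂^F b_j^{(k+1)}` and `y F` is `∂̂^F b_{j+1}^{(k+1)}`, where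
`F = 0` stands for `b̂` itself.
`step fl s x y F` consists of the new value `∂̂^F b_j^{(k)}` and of the list of the
`5 (F + 1) - 2` round-off errors committed while computing it; these are the terms
`e₁, …, e_{5 (F + 1) - 2}` of the next local error `ℓ_{F+1, j}^{(k)}`.
The values do not depend on the total number `K` of stages (as long as `F < K`). -/
noncomputable def step (fl : ℝ → ℝ) (s : ℝ) (x y : ℕ → ℝ) : ℕ → ℝ × List ℝ
  | 0 =>
    let P1 := twoProd fl (rHat fl s) (x 0)
    let P2 := twoProd fl s (y 0)
    let S := twoSum fl P1.1 P2.1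
    (S.1, [P1.2, P2.2, S.2])
  | F + 1 =>
    let l := localErrorEFT fl (step fl s x y F).2 (rho fl s) (x F)
    let P1 := twoProd fl s (y (F + 1))
    let S2 := twoSum fl l.2 P1.1
    let P3 := twoProd fl (rHat fl s) (x (F + 1))
    let S4 := twoSum fl S2.1 P3.1
    (S4.1, l.1 ++ [P1.2, S2.2, P3.2, S4.2])

/-- The table of computed values after `m` reductions: `cascade fl b s m j F` is
`∂̂^F b_j^{(n-m)}` (and `b̂_j^{(n-m)}` for `F = 0`). Initially `b̂_j^{(n)} = b_j` and
`∂̂^F b_j^{(n)} = 0` for `F ≥ 1`. -/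
noncomputable def cascade (fl : ℝ → ℝ) (b : ℕ → ℝ) (s : ℝ) : ℕ → ℕ → ℕ → ℝ
  | 0, j, F => if F = 0 then b j else 0
  | m + 1, j, F => (step fl s (cascade fl b s m j) (cascade fl b s m (j + 1)) F).1

/-- `computed fl n b s k j F = ∂̂^F b_j^{(k)}` for `k ≤ n` and `j ≤ k` (`b̂_j^{(k)}` for `F = 0`). -/
noncomputable def computed (fl : ℝ → ℝ) (n : ℕ) (b : ℕ → ℝ) (s : ℝ) (k j F : ℕ) : ℝ :=
  cascade fl b s (n - k) j F

/-- The terms `e₁, …, e_{5F-2}` of `ℓ_{F, j}^{(k)}`, for `F ≥ 1`, `k < n` and `j ≤ k`: the round-off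
errors committed while computing `∂̂^{F-1} b_j^{(k)}`. -/
noncomputable def localErrors (fl : ℝ → ℝ) (n : ℕ) (b : ℕ → ℝ) (s : ℝ) (F k j : ℕ) : List ℝ :=
  (step fl s (computed fl n b s (k + 1) j) (computed fl n b s (k + 1) (j + 1)) (F - 1)).2

/-- `ℓ̃_{F, j}^{(k)} = |e₁| + ⋯ + |e_{5F-2}| + |ρ · ∂̂^{F-1} b_j^{(k+1)}|`, for `F ≥ 1`, `k < n` and
`j ≤ k`. -/
noncomputable def ellTilde (fl : ℝ → ℝ) (n : ℕ) (b : ℕ → ℝ) (s : ℝ) (F k j : ℕ) : ℝ :=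
  ((localErrors fl n b s F k j).map (fun e => |e|)).sum
    + |rho fl s * computed fl n b s (k + 1) j (F - 1)|

/-- `L_{F, k} = ∑_{j=0}^k ℓ̃_{F, j}^{(k)} B_{j, k}(s)`, for `F ≥ 1` and `k < n`. -/
noncomputable def L (fl : ℝ → ℝ) (n : ℕ) (b : ℕ → ℝ) (s : ℝ) (F k : ℕ) : ℝ :=
  ∑ j ∈ Finset.range (k + 1), ellTilde fl n b s F k j * (bernsteinPolynomial ℝ k j).eval s

/-- `p̃(s) = ∑_{j=0}^n |b_j| B_{j, n}(s)`. -/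
noncomputable def pTilde (n : ℕ) (b : ℕ → ℝ) (s : ℝ) : ℝ :=
  ∑ j ∈ Finset.range (n + 1), |b j| * (bernsteinPolynomial ℝ n j).eval s

end CompDC

/-! ### Rounding errors of single operations and of accumulated sums. -/

namespace CompDC

/-! Weighting by Bernstein polynomials turns the two-dimensional table into a scalar recursion: an
average `(1 - s) g_j + s g_{j+1}` tested against `B_{j,k}` equals `g_j` tested against `B_{j,k+1}`
(`sum_mix_mul_bernstein`). Let `T_F(m)` and `E_F(m)` be the weighted sums of table entries and of
local errors (`tableSum`, `errorSum`); index `F` of `E` belongs to `L_{F+1}`. The node bounds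
`step_zero_bound` and `step_succ_bound` give, up to powers of `1 + u`, `E_0(m) ≤ 3u T_0(m)`,
`T_{F+1}(m+1) ≤ E_F(m) + T_{F+1}(m)`, `E_{F+1}(m) ≤ u((5F+7) E_F(m) + 3 T_{F+1}(m))`. Since `T_0(m)`
is essentially at most `p̃` and `T_{F+1}(0) = 0`, each stage costs a factor `3u` and one summation
over `m`. By the hockey-stick identity this produces `3^(F+1) * choose (m+1) F`, while the `5F+7`
term has lower degree in `m` (`exists_errorSum_le`).

Powers of `1 + u` are kept explicit throughout. They are expanded at fixed `k` or `n` for the first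
two claims, and bounded by an exponential, uniformly for bounded `n u`, for the third. -/

theorem IsRounding.abs_fl_le {u : ℝ} {fl : ℝ → ℝ} (h : IsRounding u fl) (x : ℝ) :
    |fl x| ≤ (1 + u) * |x| := by
  obtain ⟨δ, hδ, e⟩ := h.exists_mul x
  rw [e, abs_mul, mul_comm]
  refine mul_le_mul_of_nonneg_right ?_ (abs_nonneg x)
  have := abs_add_le 1 δ
  rw [abs_one] at this
  linarith

theorem IsRounding.abs_sub_fl_le {u : ℝ} {fl : ℝ → ℝ} (h : IsRounding u fl) (x : ℝ) :
    |x - fl x| ≤ u * |x| := by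
  obtain ⟨δ, hδ, e⟩ := h.exists_mul x
  have : x - fl x = -(δ * x) := by rw [e]; ring
  rw [this, abs_neg, abs_mul]
  exact mul_le_mul_of_nonneg_right hδ (abs_nonneg x)

/-- The sum of the absolute values of the entries of a list. -/
noncomputable def absSum (l : List ℝ) : ℝ := (l.map (fun e => |e|)).sum

theorem absSum_nil : absSum [] = 0 := rfl

theorem absSum_cons (a : ℝ) (l : List ℝ) : absSum (a :: l) = |a| + absSum l := by
  simp [absSum]

theorem absSum_append (l l' : List ℝ) : absSum (l ++ l') = absSum l + absSum l' := by
  simp [absSum]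

theorem absSum_nonneg (l : List ℝ) : 0 ≤ absSum l :=
  List.sum_nonneg (by simp)

theorem length_sumEFT (fl : ℝ → ℝ) (acc : ℝ) (l : List ℝ) :
    (sumEFT fl acc l).2.length = l.length := by
  induction l generalizing acc with
  | nil => rfl
  | cons x xs ih => simp [sumEFT, ih]

theorem length_step (fl : ℝ → ℝ) (s : ℝ) (x y : ℕ → ℝ) (F : ℕ) :
    (step fl s x y F).2.length = 5 * F + 3 := by
  induction F with
  | zero => rfl
  | succ F ih => simp [step, localErrorEFT, length_sumEFT, ih]; ring

/-- Each addition inflates the accumulator plus the remaining absolute sum by at most `1 + u`, and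
its error is at most `u` times that total. -/
theorem sumEFT_bound {u : ℝ} {fl : ℝ → ℝ} (h : IsRounding u fl) (acc : ℝ) (l : List ℝ) :
    |(sumEFT fl acc l).1| ≤ (1 + u) ^ l.length * (|acc| + absSum l) ∧
    absSum (sumEFT fl acc l).2 ≤
      l.length * u * (1 + u) ^ l.length * (|acc| + absSum l) := by
  have hu := h.pos
  induction l generalizing acc with
  | nil => simp [sumEFT, absSum]
  | cons x xs ih =>
    obtain ⟨h1, h2⟩ := ih (fl (acc + x))
    have hx := absSum_nonneg xs
    have hs := abs_add_le acc x
    have ha : |fl (acc + x)| + absSum xs ≤ (1 + u) * (|acc| + (|x| + absSum xs)) := by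
      have := h.abs_fl_le (acc + x)
      nlinarith [mul_le_mul_of_nonneg_left hs (by linarith : 0 ≤ 1 + u)]
    have hw : 1 ≤ (1 + u) ^ xs.length := one_le_pow₀ (by linarith)
    simp only [sumEFT, twoSum, absSum_cons, List.length_cons, pow_succ]
    constructor
    · calc _ ≤ _ := h1
        _ ≤ (1 + u) ^ xs.length * ((1 + u) * (|acc| + (|x| + absSum xs))) := by gcongr
        _ = _ := by ring
    · have he : |acc + x - fl (acc + x)| ≤
          u * ((1 + u) ^ xs.length * ((1 + u) * (|acc| + (|x| + absSum xs)))) := by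
        refine (h.abs_sub_fl_le _).trans (mul_le_mul_of_nonneg_left ?_ hu.le)
        have hS : 0 ≤ |acc| + (|x| + absSum xs) := by positivity
        calc |acc + x| ≤ 1 * (1 * (|acc| + (|x| + absSum xs))) := by linarith
          _ ≤ _ := by gcongr; linarith
      have h3 := h2.trans (mul_le_mul_of_nonneg_left ha (by positivity))
      push_cast
      linarith

theorem localErrorEFT_bound {u : ℝ} {fl : ℝ → ℝ} (h : IsRounding u fl) (e : List ℝ)
    (he : e ≠ []) (ρ d : ℝ) :
    |(localErrorEFT fl e ρ d).2| ≤ (1 + u) ^ (e.length + 2) * (absSum e + |ρ * d|) ∧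
    absSum (localErrorEFT fl e ρ d).1 ≤
      (e.length + 2) * u * (1 + u) ^ (e.length + 1) * (absSum e + |ρ * d|) := by
  have hu := h.pos
  obtain ⟨a, l, rfl⟩ := List.exists_cons_of_ne_nil he
  obtain ⟨h1, h2⟩ := sumEFT_bound h a l
  simp only [localErrorEFT, List.headD_cons, List.tail_cons, twoSum, twoProd, absSum_append,
    absSum_cons, absSum_nil, List.length_cons]
  set t := sumEFT fl a l
  set q := |ρ * d|
  set S := |a| + absSum l
  have hS : 0 ≤ S := add_nonneg (abs_nonneg _) (absSum_nonneg _)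
  have hq : 0 ≤ q := abs_nonneg _
  have hp := h.abs_fl_le (ρ * d)
  have hp' := h.abs_sub_fl_le (ρ * d)
  have hl := h.abs_fl_le (t.1 + fl (ρ * d))
  have hl' := h.abs_sub_fl_le (t.1 + fl (ρ * d))
  set W := (1 + u) ^ l.length with hW
  have hw : 1 ≤ W := one_le_pow₀ (by linarith)
  have hsum : |t.1 + fl (ρ * d)| ≤ W * (1 + u) * (S + q) := by
    have h3 := abs_add_le t.1 (fl (ρ * d))
    have h4 : W * S ≤ W * (1 + u) * S := by gcongr; nlinarith
    have h5 : (1 + u) * q ≤ W * (1 + u) * q := by gcongr; nlinarith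
    linarith
  have hm : (1 : ℝ) ≤ W * (1 + u) ^ 2 := by
    have : 1 ≤ (1 + u) ^ 2 := one_le_pow₀ (by linarith)
    nlinarith
  constructor
  · calc _ ≤ _ := hl
      _ ≤ (1 + u) * (W * (1 + u) * (S + q)) := by gcongr
      -- Only `e.length + 1` roundings occur; the extra factor here, like the extra error term `e4`
      -- below, is slack.
      _ ≤ (1 + u) * (W * (1 + u) * (S + q)) * (1 + u) := by
        apply le_mul_of_one_le_right (by positivity); linarith
      _ = _ := by rw [hW]; ring
  · have e1 : absSum t.2 ≤ l.length * u * (W * (1 + u) ^ 2) * (S + q) := by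
      refine h2.trans ?_
      gcongr
      · apply le_mul_of_one_le_right (by positivity); exact one_le_pow₀ (by linarith)
      · linarith
    have e2 : |ρ * d - fl (ρ * d)| ≤ u * (W * (1 + u) ^ 2) * (S + q) := by
      refine hp'.trans ?_
      rw [mul_assoc]
      gcongr
      nlinarith
    have e3 : |t.1 + fl (ρ * d) - fl (t.1 + fl (ρ * d))| ≤ u * (W * (1 + u) ^ 2) * (S + q) := by
      refine (hl'.trans (mul_le_mul_of_nonneg_left hsum hu.le)).trans ?_
      rw [← mul_assoc]
      gcongr
      nlinarith
    have e4 : 0 ≤ u * (W * (1 + u) ^ 2) * (S + q) := by positivity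
    have e5 : (1 + u) ^ (l.length + 1 + 1) = W * (1 + u) ^ 2 := by rw [hW]; ring
    rw [e5]
    push_cast
    linarith

/-! ### Bounds at one node of the algorithm. -/

theorem abs_rHat_le {u : ℝ} {fl : ℝ → ℝ} (h : IsRounding u fl) {s : ℝ} (hs : s ∈ Set.Icc (0 : ℝ) 1) :
    |rHat fl s| ≤ (1 + u) * (1 - s) := by
  have := h.abs_fl_le (1 + -s)
  rwa [abs_of_nonneg (by linarith [hs.2] : 0 ≤ 1 + -s)] at this

theorem abs_rho_le {u : ℝ} {fl : ℝ → ℝ} (h : IsRounding u fl) {s : ℝ} (hs : s ∈ Set.Icc (0 : ℝ) 1) :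
    |rho fl s| ≤ u * (1 - s) := by
  have := h.abs_sub_fl_le (1 + -s)
  rwa [abs_of_nonneg (by linarith [hs.2] : 0 ≤ 1 + -s)] at this

/-- The quantity `ℓ̃_{F+1}` of a single node, with inputs `x`, `y`. -/
noncomputable def stepError (fl : ℝ → ℝ) (s : ℝ) (x y : ℕ → ℝ) (F : ℕ) : ℝ :=
  absSum (step fl s x y F).2 + |rho fl s * x F|

theorem stepError_nonneg (fl : ℝ → ℝ) (s : ℝ) (x y : ℕ → ℝ) (F : ℕ) :
    0 ≤ stepError fl s x y F :=
  add_nonneg (absSum_nonneg _) (abs_nonneg _)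

/-- The constant 3 counts the first branch: product, sum and the `ρ` term. The second branch
contributes only two errors. -/
theorem step_zero_bound {u : ℝ} {fl : ℝ → ℝ} (h : IsRounding u fl) {s : ℝ}
    (hs : s ∈ Set.Icc (0 : ℝ) 1) (x y : ℕ → ℝ) :
    |(step fl s x y 0).1| ≤ (1 + u) ^ 3 * ((1 - s) * |x 0| + s * |y 0|) ∧
    stepError fl s x y 0 ≤ 3 * u * (1 + u) ^ 2 * ((1 - s) * |x 0| + s * |y 0|) := by
  have hu := h.pos
  have hs0 := hs.1
  have hs1 : 0 ≤ 1 - s := by linarith [hs.2]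
  have hX : 0 ≤ (1 - s) * |x 0| := mul_nonneg hs1 (abs_nonneg _)
  have hY : 0 ≤ s * |y 0| := mul_nonneg hs0 (abs_nonneg _)
  have hrx : |rHat fl s * x 0| ≤ (1 + u) * ((1 - s) * |x 0|) := by
    rw [abs_mul, ← mul_assoc]
    exact mul_le_mul_of_nonneg_right (abs_rHat_le h hs) (abs_nonneg _)
  have hρx : |rho fl s * x 0| ≤ u * ((1 - s) * |x 0|) := by
    rw [abs_mul, ← mul_assoc]
    exact mul_le_mul_of_nonneg_right (abs_rho_le h hs) (abs_nonneg _)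
  have hsy : |s * y 0| = s * |y 0| := by rw [abs_mul, abs_of_nonneg hs0]
  simp only [stepError, step, twoProd, twoSum, absSum_cons, absSum_nil]
  set X := (1 - s) * |x 0|
  set Y := s * |y 0|
  have p1 := h.abs_fl_le (rHat fl s * x 0)
  have p1' := h.abs_sub_fl_le (rHat fl s * x 0)
  have p2 := h.abs_fl_le (s * y 0)
  have p2' := h.abs_sub_fl_le (s * y 0)
  rw [hsy] at p2 p2'
  have p3 := h.abs_fl_le (fl (rHat fl s * x 0) + fl (s * y 0))
  have p3' := h.abs_sub_fl_le (fl (rHat fl s * x 0) + fl (s * y 0))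
  have q1 := p1.trans (mul_le_mul_of_nonneg_left hrx (by linarith))
  have q1' := p1'.trans (mul_le_mul_of_nonneg_left hrx hu.le)
  have hw : (1 + u) ≤ (1 + u) ^ 2 := by nlinarith
  have hw1 : 1 ≤ (1 + u) ^ 2 := by nlinarith
  have q3 : |fl (rHat fl s * x 0) + fl (s * y 0)| ≤ (1 + u) ^ 2 * (X + Y) := by
    have := abs_add_le (fl (rHat fl s * x 0)) (fl (s * y 0))
    linarith [mul_le_mul_of_nonneg_right hw hY]
  constructor
  · have := p3.trans (mul_le_mul_of_nonneg_left q3 (by linarith))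
    linarith
  · have r3 := p3'.trans (mul_le_mul_of_nonneg_left q3 hu.le)
    have a1 := mul_le_mul_of_nonneg_right hw (mul_nonneg hu.le hX)
    have a2 := mul_le_mul_of_nonneg_right hw1 (mul_nonneg hu.le hX)
    have a3 := mul_le_mul_of_nonneg_right hw1 (mul_nonneg hu.le hY)
    have a4 : 0 ≤ u * (1 + u) ^ 2 * Y := by positivity
    linarith

/-- Both branches now contribute three errors: the first has its product, the last sum and the `ρ`
term, the second its product and two sums. The coefficient `5F + 7` is `5F + 5` from the local error
evaluation plus the two later sums. -/
theorem step_succ_bound {u : ℝ} {fl : ℝ → ℝ} (h : IsRounding u fl) {s : ℝ}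
    (hs : s ∈ Set.Icc (0 : ℝ) 1) (x y : ℕ → ℝ) (F : ℕ) :
    |(step fl s x y (F + 1)).1| ≤ (1 + u) ^ (5 * F + 7) * stepError fl s x y F
      + (1 + u) ^ 3 * ((1 - s) * |x (F + 1)| + s * |y (F + 1)|) ∧
    stepError fl s x y (F + 1) ≤
      u * ((5 * F + 7) * (1 + u) ^ (5 * F + 6) * stepError fl s x y F
        + 3 * (1 + u) ^ 2 * ((1 - s) * |x (F + 1)| + s * |y (F + 1)|)) := by
  have hu := h.pos
  have hs0 := hs.1
  have hs1 : 0 ≤ 1 - s := by linarith [hs.2]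
  have hX : 0 ≤ (1 - s) * |x (F + 1)| := mul_nonneg hs1 (abs_nonneg _)
  have hY : 0 ≤ s * |y (F + 1)| := mul_nonneg hs0 (abs_nonneg _)
  have hrx : |rHat fl s * x (F + 1)| ≤ (1 + u) * ((1 - s) * |x (F + 1)|) := by
    rw [abs_mul, ← mul_assoc]
    exact mul_le_mul_of_nonneg_right (abs_rHat_le h hs) (abs_nonneg _)
  have hρx : |rho fl s * x (F + 1)| ≤ u * ((1 - s) * |x (F + 1)|) := by
    rw [abs_mul, ← mul_assoc]
    exact mul_le_mul_of_nonneg_right (abs_rho_le h hs) (abs_nonneg _)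
  have hsy : |s * y (F + 1)| = s * |y (F + 1)| := by rw [abs_mul, abs_of_nonneg hs0]
  have hne : (step fl s x y F).2 ≠ [] := by
    rw [← List.length_pos_iff, length_step]; omega
  obtain ⟨l1, l2⟩ := localErrorEFT_bound h (step fl s x y F).2 hne (rho fl s) (x F)
  rw [length_step] at l1 l2
  change _ ≤ _ * stepError fl s x y F at l1
  change _ ≤ _ * stepError fl s x y F at l2
  have hE := stepError_nonneg fl s x y F
  generalize stepError fl s x y F = E at *
  simp only [stepError, step, twoProd, twoSum, absSum_append, absSum_cons, absSum_nil]
  generalize localErrorEFT fl (step fl s x y F).2 (rho fl s) (x F) = l at *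
  generalize (1 - s) * |x (F + 1)| = X at *
  generalize s * |y (F + 1)| = Y at *
  have p1 := h.abs_fl_le (s * y (F + 1))
  have p1' := h.abs_sub_fl_le (s * y (F + 1))
  rw [hsy] at p1 p1'
  have p3 := h.abs_fl_le (rHat fl s * x (F + 1))
  have p3' := h.abs_sub_fl_le (rHat fl s * x (F + 1))
  generalize rHat fl s * x (F + 1) = rx at *
  generalize s * y (F + 1) = sy at *
  have p2 := h.abs_fl_le (l.2 + fl sy)
  have p2' := h.abs_sub_fl_le (l.2 + fl sy)
  have p4 := h.abs_fl_le (fl (l.2 + fl sy) + fl rx)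
  have p4' := h.abs_sub_fl_le (fl (l.2 + fl sy) + fl rx)
  have q3 := p3.trans (mul_le_mul_of_nonneg_left hrx (by linarith))
  have q3' := p3'.trans (mul_le_mul_of_nonneg_left hrx hu.le)
  have e5 : (1 + u) ^ (5 * F + 3 + 2) = (1 + u) ^ (5 * F + 5) := rfl
  have e6 : (1 + u) ^ (5 * F + 6) = (1 + u) ^ (5 * F + 5) * (1 + u) := pow_succ _ _
  have e7 : (1 + u) ^ (5 * F + 7) = (1 + u) ^ (5 * F + 5) * (1 + u) ^ 2 := pow_add _ (5 * F + 5) 2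
  have e4 : (1 + u) ^ (5 * F + 3 + 1) ≤ (1 + u) ^ (5 * F + 5) * (1 + u) := by
    rw [← pow_succ]; exact pow_le_pow_right₀ (by linarith) (by omega)
  have hW : 1 ≤ (1 + u) ^ (5 * F + 5) := one_le_pow₀ (by linarith)
  rw [e5] at l1
  rw [e6, e7]
  have q2 : |l.2 + fl sy| ≤ (1 + u) ^ (5 * F + 5) * E + (1 + u) * Y := by
    have := abs_add_le l.2 (fl sy)
    linarith
  have q4 : |fl (l.2 + fl sy) + fl rx| ≤
      (1 + u) ^ (5 * F + 5) * (1 + u) * E + (1 + u) ^ 2 * (X + Y) := by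
    have := abs_add_le (fl (l.2 + fl sy)) (fl rx)
    have := p2.trans (mul_le_mul_of_nonneg_left q2 (by linarith))
    linarith
  constructor
  · have := p4.trans (mul_le_mul_of_nonneg_left q4 (by linarith))
    linarith
  · have r2 := p2'.trans (mul_le_mul_of_nonneg_left q2 hu.le)
    have r4 := p4'.trans (mul_le_mul_of_nonneg_left q4 hu.le)
    have l3 : absSum l.1 ≤ (5 * F + 5) * u * ((1 + u) ^ (5 * F + 5) * (1 + u)) * E := by
      refine l2.trans ?_
      push_cast
      rw [show (5 * (F : ℝ) + 3 + 2) = 5 * F + 5 by ring]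
      gcongr
    generalize (1 + u) ^ (5 * F + 5) = W at *
    have a1 : u * (W * E) ≤ u * (W * (1 + u) * E) := by
      have : W * E ≤ W * (1 + u) * E := by
        gcongr; nlinarith
      exact mul_le_mul_of_nonneg_left this hu.le
    have hw : (1 + u) ≤ (1 + u) ^ 2 := by nlinarith
    have hw1 : 1 ≤ (1 + u) ^ 2 := by nlinarith
    have b1 := mul_le_mul_of_nonneg_right hw (mul_nonneg hu.le hX)
    have b2 := mul_le_mul_of_nonneg_right hw1 (mul_nonneg hu.le hX)
    have b3 := mul_le_mul_of_nonneg_right hw1 (mul_nonneg hu.le hY)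
    have b4 := mul_le_mul_of_nonneg_right hw (mul_nonneg hu.le hY)
    linarith

/-! ### Bernstein weights and the de Casteljau average. -/

theorem eval_bernstein_nonneg {s : ℝ} (hs : s ∈ Set.Icc (0 : ℝ) 1) (k j : ℕ) :
    0 ≤ (bernsteinPolynomial ℝ k j).eval s := by
  have h0 := hs.1
  have h1 : 0 ≤ 1 - s := by linarith [hs.2]
  simp only [bernsteinPolynomial, Polynomial.eval_mul, Polynomial.eval_natCast,
    Polynomial.eval_pow, Polynomial.eval_X, Polynomial.eval_sub, Polynomial.eval_one]
  positivity

theorem eval_bernstein_succ_zero (s : ℝ) (k : ℕ) :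
    (bernsteinPolynomial ℝ (k + 1) 0).eval s = (1 - s) * (bernsteinPolynomial ℝ k 0).eval s := by
  simp [bernsteinPolynomial, pow_succ, mul_comm]

theorem eval_bernstein_succ_succ (s : ℝ) {k j : ℕ} (hj : j ≤ k) :
    (bernsteinPolynomial ℝ (k + 1) (j + 1)).eval s =
      (1 - s) * (bernsteinPolynomial ℝ k (j + 1)).eval s
        + s * (bernsteinPolynomial ℝ k j).eval s := by
  simp only [bernsteinPolynomial, Polynomial.eval_mul, Polynomial.eval_natCast,
    Polynomial.eval_pow, Polynomial.eval_X, Polynomial.eval_sub, Polynomial.eval_one]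
  rw [Nat.choose_succ_succ, Nat.add_sub_add_right]
  push_cast
  -- At `j = k` the truncated exponent `k - (j + 1)` is harmless, because its binomial coefficient
  -- vanishes.
  rcases hj.lt_or_eq with h | rfl
  · obtain ⟨d, rfl⟩ := Nat.exists_eq_add_of_lt h
    rw [show j + d + 1 - j = d + 1 by omega, show j + d + 1 - (j + 1) = d by omega]
    ring
  · simp; ring

theorem sum_mix_mul_bernstein (s : ℝ) (k : ℕ) (g : ℕ → ℝ) :
    ∑ j ∈ Finset.range (k + 1),
        ((1 - s) * g j + s * g (j + 1)) * (bernsteinPolynomial ℝ k j).eval s =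
      ∑ j ∈ Finset.range (k + 2), g j * (bernsteinPolynomial ℝ (k + 1) j).eval s := by
  -- The term `j = k + 1` vanishes; adding it lets both sums be split at `j = 0`.
  have hk : ∑ j ∈ Finset.range (k + 1), g j * (bernsteinPolynomial ℝ k j).eval s
      = ∑ j ∈ Finset.range (k + 2), g j * (bernsteinPolynomial ℝ k j).eval s := by
    rw [Finset.sum_range_succ _ (k + 1), bernsteinPolynomial.eq_zero_of_lt ℝ (Nat.lt_succ_self k)]
    simp
  have h1 : ∑ j ∈ Finset.range (k + 1),
        ((1 - s) * g j + s * g (j + 1)) * (bernsteinPolynomial ℝ k j).eval s =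
      (1 - s) * (∑ j ∈ Finset.range (k + 1), g j * (bernsteinPolynomial ℝ k j).eval s)
      + ∑ j ∈ Finset.range (k + 1), s * g (j + 1) * (bernsteinPolynomial ℝ k j).eval s := by
    rw [Finset.mul_sum, ← Finset.sum_add_distrib]
    exact Finset.sum_congr rfl fun j _ => by ring
  rw [h1, hk, Finset.sum_range_succ' _ (k + 1), Finset.sum_range_succ' _ (k + 1),
    eval_bernstein_succ_zero, mul_add, Finset.mul_sum, add_right_comm, ← Finset.sum_add_distrib]
  congr 1
  · refine Finset.sum_congr rfl fun j hj => ?_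
    rw [eval_bernstein_succ_succ s (Nat.lt_succ_iff.mp (Finset.mem_range.mp hj))]
    ring
  · ring


/-! ### Scalar recursion for the weighted sums. -/

/-- The Bernstein-weighted sum of the absolute values of the table entries after `m` reductions. -/
noncomputable def tableSum (fl : ℝ → ℝ) (n : ℕ) (b : ℕ → ℝ) (s : ℝ) (F m : ℕ) : ℝ :=
  ∑ j ∈ Finset.range (n - m + 1),
    |cascade fl b s m j F| * (bernsteinPolynomial ℝ (n - m) j).eval s

/-- The Bernstein-weighted sum of the local errors of the reduction following `m` reductions. -/
noncomputable def errorSum (fl : ℝ → ℝ) (n : ℕ) (b : ℕ → ℝ) (s : ℝ) (F m : ℕ) : ℝ :=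
  ∑ j ∈ Finset.range (n - (m + 1) + 1),
    stepError fl s (cascade fl b s m j) (cascade fl b s m (j + 1)) F
      * (bernsteinPolynomial ℝ (n - (m + 1)) j).eval s

theorem L_eq_errorSum (fl : ℝ → ℝ) {n m : ℕ} (hm : m < n) (b : ℕ → ℝ) (s : ℝ) (F : ℕ) :
    L fl n b s (F + 1) (n - (m + 1)) = errorSum fl n b s F m := by
  have : n - (n - (m + 1) + 1) = m := by omega
  have hc : computed fl n b s (n - (m + 1) + 1) = cascade fl b s m := by
    funext j F
    rw [computed, this]
  simp only [L, errorSum, ellTilde, localErrors, hc, stepError, absSum, Nat.add_sub_cancel]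

theorem errorSum_nonneg (fl : ℝ → ℝ) (n : ℕ) (b : ℕ → ℝ) {s : ℝ} (hs : s ∈ Set.Icc (0 : ℝ) 1)
    (F m : ℕ) : 0 ≤ errorSum fl n b s F m :=
  Finset.sum_nonneg fun _ _ => mul_nonneg (stepError_nonneg _ _ _ _ _) (eval_bernstein_nonneg hs _ _)

theorem pTilde_nonneg (n : ℕ) (b : ℕ → ℝ) {s : ℝ} (hs : s ∈ Set.Icc (0 : ℝ) 1) :
    0 ≤ pTilde n b s :=
  Finset.sum_nonneg fun _ _ => mul_nonneg (abs_nonneg _) (eval_bernstein_nonneg hs _ _)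

theorem sum_bernstein_le {s : ℝ} (hs : s ∈ Set.Icc (0 : ℝ) 1) (k : ℕ) (α β : ℝ) (f e g : ℕ → ℝ)
    (hf : ∀ j, f j ≤ α * e j + β * ((1 - s) * g j + s * g (j + 1))) :
    ∑ j ∈ Finset.range (k + 1), f j * (bernsteinPolynomial ℝ k j).eval s ≤
      α * ∑ j ∈ Finset.range (k + 1), e j * (bernsteinPolynomial ℝ k j).eval s
        + β * ∑ j ∈ Finset.range (k + 2), g j * (bernsteinPolynomial ℝ (k + 1) j).eval s := by
  rw [← sum_mix_mul_bernstein, Finset.mul_sum, Finset.mul_sum, ← Finset.sum_add_distrib]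
  refine Finset.sum_le_sum fun j _ => ?_
  calc _ ≤ _ := mul_le_mul_of_nonneg_right (hf j) (eval_bernstein_nonneg hs k j)
    _ = _ := by ring

section Recursion

variable {u : ℝ} {fl : ℝ → ℝ} (h : IsRounding u fl) {s : ℝ} (hs : s ∈ Set.Icc (0 : ℝ) 1)
  (b : ℕ → ℝ) {n m : ℕ} (hm : m < n)
include h hs hm

theorem tableSum_zero_succ_le :
    tableSum fl n b s 0 (m + 1) ≤ (1 + u) ^ 3 * tableSum fl n b s 0 m := by
  have := sum_bernstein_le hs (n - (m + 1)) 0 ((1 + u) ^ 3) (fun j => |cascade fl b s (m + 1) j 0|)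
    (fun _ => 0) (fun j => |cascade fl b s m j 0|) (fun j => by
      rw [zero_mul, zero_add]; exact (step_zero_bound h hs _ _).1)
  rw [zero_mul, zero_add, show n - (m + 1) + 2 = n - m + 1 by omega,
    show n - (m + 1) + 1 = n - m by omega] at this
  rwa [tableSum, tableSum, show n - (m + 1) + 1 = n - m by omega]

theorem errorSum_zero_le :
    errorSum fl n b s 0 m ≤ 3 * u * (1 + u) ^ 2 * tableSum fl n b s 0 m := by
  have := sum_bernstein_le hs (n - (m + 1)) 0 (3 * u * (1 + u) ^ 2)
    (fun j => stepError fl s (cascade fl b s m j) (cascade fl b s m (j + 1)) 0)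
    (fun _ => 0) (fun j => |cascade fl b s m j 0|) (fun j => by
      rw [zero_mul, zero_add]; exact (step_zero_bound h hs _ _).2)
  rw [zero_mul, zero_add, show n - (m + 1) + 2 = n - m + 1 by omega,
    show n - (m + 1) + 1 = n - m by omega] at this
  rwa [errorSum, tableSum, show n - (m + 1) + 1 = n - m by omega]

theorem tableSum_succ_succ_le (F : ℕ) :
    tableSum fl n b s (F + 1) (m + 1) ≤ (1 + u) ^ (5 * F + 7) * errorSum fl n b s F m
      + (1 + u) ^ 3 * tableSum fl n b s (F + 1) m := by
  have := sum_bernstein_le hs (n - (m + 1)) ((1 + u) ^ (5 * F + 7)) ((1 + u) ^ 3)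
    (fun j => |cascade fl b s (m + 1) j (F + 1)|)
    (fun j => stepError fl s (cascade fl b s m j) (cascade fl b s m (j + 1)) F)
    (fun j => |cascade fl b s m j (F + 1)|) (fun j => (step_succ_bound h hs _ _ F).1)
  rw [show n - (m + 1) + 2 = n - m + 1 by omega,
    show n - (m + 1) + 1 = n - m by omega] at this
  rwa [tableSum, tableSum, errorSum, show n - (m + 1) + 1 = n - m by omega]

theorem errorSum_succ_le (F : ℕ) :
    errorSum fl n b s (F + 1) m ≤
      u * ((5 * F + 7) * (1 + u) ^ (5 * F + 6) * errorSum fl n b s F m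
        + 3 * (1 + u) ^ 2 * tableSum fl n b s (F + 1) m) := by
  have := sum_bernstein_le hs (n - (m + 1)) (u * ((5 * F + 7) * (1 + u) ^ (5 * F + 6)))
    (u * (3 * (1 + u) ^ 2))
    (fun j => stepError fl s (cascade fl b s m j) (cascade fl b s m (j + 1)) (F + 1))
    (fun j => stepError fl s (cascade fl b s m j) (cascade fl b s m (j + 1)) F)
    (fun j => |cascade fl b s m j (F + 1)|) (fun j => by
      have := (step_succ_bound h hs (cascade fl b s m j) (cascade fl b s m (j + 1)) F).2
      linarith)
  rw [show n - (m + 1) + 2 = n - m + 1 by omega,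
    show n - (m + 1) + 1 = n - m by omega] at this
  rw [tableSum, errorSum, errorSum, show n - (m + 1) + 1 = n - m by omega]
  linarith

end Recursion

theorem tableSum_zero_zero (fl : ℝ → ℝ) (n : ℕ) (b : ℕ → ℝ) (s : ℝ) :
    tableSum fl n b s 0 0 = pTilde n b s := by
  simp [tableSum, pTilde, cascade]

theorem tableSum_succ_zero (fl : ℝ → ℝ) (n : ℕ) (b : ℕ → ℝ) (s : ℝ) (F : ℕ) :
    tableSum fl n b s (F + 1) 0 = 0 := by
  simp [tableSum, cascade]

theorem tableSum_zero_le {u : ℝ} {fl : ℝ → ℝ} (h : IsRounding u fl) {s : ℝ}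
    (hs : s ∈ Set.Icc (0 : ℝ) 1) (b : ℕ → ℝ) {n m : ℕ} (hm : m ≤ n) :
    tableSum fl n b s 0 m ≤ (1 + u) ^ (3 * m) * pTilde n b s := by
  have hu := h.pos
  induction m with
  | zero => simp [tableSum_zero_zero]
  | succ m ih =>
    calc _ ≤ _ := tableSum_zero_succ_le h hs b hm
      _ ≤ (1 + u) ^ 3 * ((1 + u) ^ (3 * m) * pTilde n b s) := by
        gcongr; exact ih (by omega)
      _ = _ := by ring

/-- If the error sums of stage `F` obey a bound `a`, then the table sums obey the summed bound. -/
theorem tableSum_succ_le_of_errorSum_le {u : ℝ} {fl : ℝ → ℝ} (h : IsRounding u fl) {s : ℝ}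
    (hs : s ∈ Set.Icc (0 : ℝ) 1) (b : ℕ → ℝ) {n F E : ℕ} {q : ℝ} (a : ℕ → ℝ)
    (ha : ∀ m < n, errorSum fl n b s F m ≤ (1 + u) ^ (3 * (m + 1) + E) * q * a m)
    {m : ℕ} (hm : m ≤ n) :
    tableSum fl n b s (F + 1) m ≤
      (1 + u) ^ (3 * m + E + (5 * F + 7)) * q * ∑ i ∈ Finset.range m, a i := by
  have hu := h.pos
  induction m with
  | zero => simp [tableSum_succ_zero]
  | succ m ih =>
    -- The exponent `3 * (m + 1) + E` in `ha` gives both contributions the same power of `1 + u`, so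
    -- the bounds add without loss.
    calc _ ≤ _ := tableSum_succ_succ_le h hs b hm F
      _ ≤ (1 + u) ^ (5 * F + 7) * ((1 + u) ^ (3 * (m + 1) + E) * q * a m)
          + (1 + u) ^ 3 * ((1 + u) ^ (3 * m + E + (5 * F + 7)) * q
            * ∑ i ∈ Finset.range m, a i) := by
        gcongr
        · exact ha m hm
        · exact ih (by omega)
      _ = _ := by rw [Finset.sum_range_succ]; ring

/-! ### Binomial sums and the induction on the stage. -/

theorem sum_choose_succ_le (n G : ℕ) :
    ∑ i ∈ Finset.range n, (i + 1).choose G ≤ (n + 1).choose (G + 1) := by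
  induction n with
  | zero => simp
  | succ n ih =>
    rw [Finset.sum_range_succ, Nat.choose_succ_succ (n + 1) G]
    simp only [Nat.succ_eq_add_one]
    omega

/-- The hockey-stick sum applied twice: passing from `n` to `n + 1` adds one more copy of every
earlier summand. -/
theorem sum_mul_choose_succ_le (n G : ℕ) :
    ∑ m ∈ Finset.range n, (n - (m + 1)) * (m + 1).choose G ≤ (n + 1).choose (G + 2) := by
  induction n with
  | zero => simp
  | succ n ih =>
    have h1 : ∑ m ∈ Finset.range n, (n + 1 - (m + 1)) * (m + 1).choose G =
        ∑ m ∈ Finset.range n, (n - (m + 1)) * (m + 1).choose G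
          + ∑ m ∈ Finset.range n, (m + 1).choose G := by
      rw [← Finset.sum_add_distrib]
      refine Finset.sum_congr rfl fun m hm => ?_
      have := Finset.mem_range.mp hm
      rw [show n + 1 - (m + 1) = n - (m + 1) + 1 by omega]
      ring
    have h2 := sum_choose_succ_le n G
    rw [Finset.sum_range_succ, h1, Nat.choose_succ_succ' (n + 1) (G + 1), Nat.sub_self, zero_mul]
    rw [show G + 1 + 1 = G + 2 from rfl]
    omega

/-- The leading coefficient of the bound for the error sums of stage `G` after `m` reductions. -/
noncomputable def coeff (A : ℝ) (G m : ℕ) : ℝ :=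
  (3 : ℝ) ^ (G + 1) * ((m + 1).choose G : ℝ) + A * G * ((m : ℝ) + 1) ^ (G - 1)

theorem mul_pow_pred_le (G : ℕ) {x : ℝ} (hx : 1 ≤ x) : (G : ℝ) * x ^ (G - 1) ≤ G * x ^ G :=
  mul_le_mul_of_nonneg_left (pow_le_pow_right₀ hx (Nat.sub_le _ _)) (Nat.cast_nonneg _)

/-- The factor `G` neutralises the truncated exponent `G - 1` at `G = 0`; this is why `coeff`
carries it. -/
theorem mul_mul_pow_pred (G : ℕ) (x : ℝ) : (G : ℝ) * (x * x ^ (G - 1)) = G * x ^ G := by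
  rcases G with _ | G
  · simp
  · rw [Nat.add_sub_cancel, pow_succ']

theorem choose_le_pow_real (k G : ℕ) : (k.choose G : ℝ) ≤ (k : ℝ) ^ G := by
  exact_mod_cast Nat.choose_le_pow k G

theorem coeff_nonneg {A : ℝ} (hA : 0 ≤ A) (G m : ℕ) : 0 ≤ coeff A G m := by
  unfold coeff; positivity

theorem coeff_le {A : ℝ} (hA : 0 ≤ A) (G m : ℕ) :
    coeff A G m ≤ (3 ^ (G + 1) + A * G) * ((m : ℝ) + 1) ^ G := by
  have h1 := choose_le_pow_real (m + 1) G
  push_cast at h1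
  have h2 := mul_pow_pred_le G (x := (m : ℝ) + 1) (by linarith [Nat.cast_nonneg (α := ℝ) m])
  have h3 := mul_le_mul_of_nonneg_left h2 hA
  have h4 := mul_le_mul_of_nonneg_left h1 (by positivity : (0 : ℝ) ≤ 3 ^ (G + 1))
  unfold coeff
  linarith

theorem sum_coeff_le {A : ℝ} (hA : 0 ≤ A) (G m : ℕ) :
    ∑ i ∈ Finset.range m, coeff A G i ≤
      3 ^ (G + 1) * ((m + 1).choose (G + 1) : ℝ) + A * G * ((m : ℝ) + 1) ^ G := by
  simp only [coeff]
  rw [Finset.sum_add_distrib, ← Finset.mul_sum, ← Finset.mul_sum]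
  have h1 : ∑ i ∈ Finset.range m, ((i + 1).choose G : ℝ) ≤ ((m + 1).choose (G + 1) : ℝ) := by
    exact_mod_cast sum_choose_succ_le m G
  have h2 : ∑ i ∈ Finset.range m, ((i : ℝ) + 1) ^ (G - 1) ≤
      ((m : ℝ) + 1) * ((m : ℝ) + 1) ^ (G - 1) := by
    calc _ ≤ ∑ i ∈ Finset.range m, ((m : ℝ) + 1) ^ (G - 1) := by
          refine Finset.sum_le_sum fun i hi => ?_
          have : (i : ℝ) ≤ m := by exact_mod_cast (Finset.mem_range.mp hi).le
          gcongr
      _ = m * ((m : ℝ) + 1) ^ (G - 1) := by simp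
      _ ≤ _ := by gcongr; linarith
  have h3 := mul_le_mul_of_nonneg_left h2 (by positivity : (0 : ℝ) ≤ A * G)
  have h4 := mul_mul_pow_pred G ((m : ℝ) + 1)
  have h5 := mul_le_mul_of_nonneg_left h1 (by positivity : (0 : ℝ) ≤ 3 ^ (G + 1))
  calc _ ≤ _ := add_le_add h5 h3
    _ = _ := by rw [mul_assoc A, h4]; ring

theorem exists_errorSum_le (G : ℕ) :
    ∃ (A : ℝ) (E : ℕ), 0 ≤ A ∧ ∀ (u : ℝ) (fl : ℝ → ℝ), IsRounding u fl →
      ∀ (n : ℕ) (b : ℕ → ℝ) (s : ℝ), s ∈ Set.Icc (0 : ℝ) 1 → ∀ m < n,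
        errorSum fl n b s G m ≤
          (1 + u) ^ (3 * (m + 1) + E) * (u ^ (G + 1) * pTilde n b s) * coeff A G m := by
  induction G with
  | zero =>
    refine ⟨0, 0, le_rfl, fun u fl h n b s hs m hm => ?_⟩
    have hu := h.pos
    have hp := pTilde_nonneg n b hs
    calc _ ≤ _ := errorSum_zero_le h hs b hm
      _ ≤ 3 * u * (1 + u) ^ 2 * ((1 + u) ^ (3 * m) * pTilde n b s) := by
        gcongr; exact tableSum_zero_le h hs b hm.le
      _ ≤ 3 * u * (1 + u) ^ 2 * ((1 + u) ^ (3 * m) * pTilde n b s) * (1 + u) :=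
        le_mul_of_one_le_right (by positivity) (by linarith)
      _ = _ := by simp [coeff]; ring
  | succ G ih =>
    obtain ⟨A, E, hA, ih⟩ := ih
    -- Lower-order contributions: all of the `5G + 7` term, bounded by `coeff_le`, and the
    -- non-binomial part of three times `sum_coeff_le`.
    set A' := (5 * G + 7) * (3 ^ (G + 1) + A * G) + 3 * (A * G) with hA'
    have hA'0 : 0 ≤ A' := by positivity
    refine ⟨A', E + (5 * G + 9), hA'0, fun u fl h n b s hs m hm => ?_⟩
    have hu := h.pos
    have hp := pTilde_nonneg n b hs
    have h1 := ih u fl h n b s hs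
    have h2 := tableSum_succ_le_of_errorSum_le h hs b (coeff A G) h1 hm.le
    have h3 := errorSum_succ_le h hs b hm G
    have hc := coeff_nonneg hA G m
    have hW : (1 + u) ^ (5 * G + 6) * (1 + u) ^ (3 * (m + 1) + E) ≤
        (1 + u) ^ (3 * (m + 1) + (E + (5 * G + 9))) := by
      rw [← pow_add]; exact pow_le_pow_right₀ (by linarith) (by omega)
    have hW' : (1 + u) ^ 2 * (1 + u) ^ (3 * m + E + (5 * G + 7)) ≤
        (1 + u) ^ (3 * (m + 1) + (E + (5 * G + 9))) := by
      rw [← pow_add]; exact pow_le_pow_right₀ (by linarith) (by omega)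
    have hS : 0 ≤ ∑ i ∈ Finset.range m, coeff A G i :=
      Finset.sum_nonneg fun i _ => coeff_nonneg hA G i
    set W := (1 + u) ^ (3 * (m + 1) + (E + (5 * G + 9))) with hWdef
    set q := u ^ (G + 1) * pTilde n b s with hq
    have hq0 : 0 ≤ q := by positivity
    have hfin : (5 * G + 7) * coeff A G m + 3 * ∑ i ∈ Finset.range m, coeff A G i ≤
        coeff A' (G + 1) m := by
      have c1 := mul_le_mul_of_nonneg_left (coeff_le hA G m) (by positivity : (0 : ℝ) ≤ 5 * G + 7)
      have c2 := sum_coeff_le hA G m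
      have c3 : A' * ((m : ℝ) + 1) ^ G ≤ A' * ((G + 1 : ℕ) : ℝ) * ((m : ℝ) + 1) ^ G := by
        gcongr
        apply le_mul_of_one_le_right hA'0
        push_cast
        linarith [Nat.cast_nonneg (α := ℝ) G]
      have c5 : coeff A' (G + 1) m = 3 ^ (G + 1) * 3 * ((m + 1).choose (G + 1) : ℝ)
          + A' * ((G + 1 : ℕ) : ℝ) * ((m : ℝ) + 1) ^ G := by
        rw [coeff, Nat.add_sub_cancel, pow_succ (3 : ℝ) (G + 1)]
      rw [c5]
      have c4 : A' * ((m : ℝ) + 1) ^ G = (5 * G + 7) * ((3 ^ (G + 1) + A * G) * ((m : ℝ) + 1) ^ G)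
          + 3 * (A * G * ((m : ℝ) + 1) ^ G) := by rw [hA']; ring
      linarith
    calc _ ≤ _ := h3
      _ ≤ u * ((5 * G + 7) * (1 + u) ^ (5 * G + 6) *
            ((1 + u) ^ (3 * (m + 1) + E) * q * coeff A G m)
          + 3 * (1 + u) ^ 2 * ((1 + u) ^ (3 * m + E + (5 * G + 7)) * q
            * ∑ i ∈ Finset.range m, coeff A G i)) := by
        gcongr
        exact h1 m hm
      _ = u * q * ((5 * G + 7) * (((1 + u) ^ (5 * G + 6) * (1 + u) ^ (3 * (m + 1) + E))
            * coeff A G m) + 3 * (((1 + u) ^ 2 * (1 + u) ^ (3 * m + E + (5 * G + 7)))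
            * ∑ i ∈ Finset.range m, coeff A G i)) := by ring
      _ ≤ u * q * ((5 * G + 7) * (W * coeff A G m)
            + 3 * (W * ∑ i ∈ Finset.range m, coeff A G i)) := by gcongr
      _ = W * (u * q) * ((5 * G + 7) * coeff A G m
            + 3 * ∑ i ∈ Finset.range m, coeff A G i) := by ring
      _ ≤ W * (u * q) * coeff A' (G + 1) m := by gcongr
      _ = _ := by rw [hq]; ring

/-! ### The sum weighted by `γ`. -/

/-- The constant in the lower order term of the weighted sum of the error bounds. -/
noncomputable def sumConst (A : ℝ) (G : ℕ) : ℝ :=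
  3 ^ (G + 2) + 3 * (A * G) + 5 * (G + 1) * (3 ^ (G + 1) + A * G)

theorem sumConst_nonneg {A : ℝ} (hA : 0 ≤ A) (G : ℕ) : 0 ≤ sumConst A G := by
  unfold sumConst; positivity

/-- Only `3 (n - m - 1)` times the binomial part of `coeff` reaches degree `G + 2` in `n`. Pascal's
rule moves `choose (n+1) (G+2)` to `choose n (G+2)` at a cost of `n^(G+1)`. -/
theorem sum_weight_mul_coeff_le {A : ℝ} (hA : 0 ≤ A) (G n : ℕ) :
    ∑ m ∈ Finset.range n, ((3 * (n - (m + 1)) + 5 * (G + 1) : ℕ) : ℝ) * coeff A G m ≤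
      3 ^ (G + 2) * (n.choose (G + 2) : ℝ) + sumConst A G * (n : ℝ) ^ (G + 1) := by
  have h1 : ∑ m ∈ Finset.range n, ((n - (m + 1) : ℕ) : ℝ) * ((m + 1).choose G : ℝ) ≤
      (n.choose (G + 2) : ℝ) + (n : ℝ) ^ (G + 1) := by
    have h : ∑ m ∈ Finset.range n, ((n - (m + 1) : ℕ) : ℝ) * ((m + 1).choose G : ℝ) ≤
        ((n + 1).choose (G + 2) : ℝ) := by exact_mod_cast sum_mul_choose_succ_le n G
    rw [Nat.choose_succ_succ n (G + 1)] at h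
    push_cast at h
    linarith [choose_le_pow_real n (G + 1)]
  have hmn : ∀ m ∈ Finset.range n, (m : ℝ) + 1 ≤ n := fun m hm => by
    exact_mod_cast Finset.mem_range.mp hm
  have h2 : ∑ m ∈ Finset.range n, ((n - (m + 1) : ℕ) : ℝ) * (G * ((m : ℝ) + 1) ^ (G - 1)) ≤
      G * (n : ℝ) ^ (G + 1) := by
    calc _ ≤ ∑ m ∈ Finset.range n, (n : ℝ) * (G * (n : ℝ) ^ (G - 1)) := by
          refine Finset.sum_le_sum fun m hm => ?_
          have := hmn m hm
          gcongr
          exact Nat.sub_le _ _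
      _ = n * (G * (n * (n : ℝ) ^ (G - 1))) := by
          rw [Finset.sum_const, Finset.card_range, nsmul_eq_mul]; ring
      _ = _ := by rw [mul_mul_pow_pred]; ring
  have h3 : ∑ m ∈ Finset.range n, coeff A G m ≤ (3 ^ (G + 1) + A * G) * (n : ℝ) ^ (G + 1) := by
    calc _ ≤ ∑ m ∈ Finset.range n, (3 ^ (G + 1) + A * G) * (n : ℝ) ^ G := by
          refine Finset.sum_le_sum fun m hm => (coeff_le hA G m).trans ?_
          have := hmn m hm
          gcongr
      _ = _ := by rw [Finset.sum_const, Finset.card_range, nsmul_eq_mul]; ring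
  have h4 : ∑ m ∈ Finset.range n, ((3 * (n - (m + 1)) + 5 * (G + 1) : ℕ) : ℝ) * coeff A G m =
      3 ^ (G + 2) * ∑ m ∈ Finset.range n, ((n - (m + 1) : ℕ) : ℝ) * ((m + 1).choose G : ℝ)
      + 3 * A * ∑ m ∈ Finset.range n, ((n - (m + 1) : ℕ) : ℝ) * (G * ((m : ℝ) + 1) ^ (G - 1))
      + 5 * (G + 1) * ∑ m ∈ Finset.range n, coeff A G m := by
    rw [Finset.mul_sum, Finset.mul_sum, Finset.mul_sum, ← Finset.sum_add_distrib,
      ← Finset.sum_add_distrib]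
    refine Finset.sum_congr rfl fun m _ => ?_
    unfold coeff
    push_cast
    ring
  rw [h4, sumConst]
  have k1 := mul_le_mul_of_nonneg_left h1 (by positivity : (0 : ℝ) ≤ 3 ^ (G + 2))
  have k2 := mul_le_mul_of_nonneg_left h2 (by positivity : (0 : ℝ) ≤ 3 * A)
  have k3 := mul_le_mul_of_nonneg_left h3 (by positivity : (0 : ℝ) ≤ 5 * (G + 1))
  linarith

theorem gamma_nonneg {u : ℝ} (hu : 0 ≤ u) {m : ℕ} (hm : (m : ℝ) * u ≤ 1 / 2) :
    0 ≤ gamma u m := by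
  have : 0 ≤ 1 - m * u := by linarith
  unfold gamma; positivity

/-- This is `1/(1 - x) ≤ 1 + 2x` for `0 ≤ x ≤ 1/2`; using `M` in the correction makes it common to
all summands. -/
theorem gamma_le {u : ℝ} (hu : 0 ≤ u) {m M : ℕ} (hmM : m ≤ M) (hM : (M : ℝ) * u ≤ 1 / 2) :
    gamma u m ≤ (m * u) * (1 + 2 * (M * u)) := by
  have hmu : (m : ℝ) * u ≤ M * u := by gcongr
  have h0 : 0 ≤ (m : ℝ) * u := by positivity
  unfold gamma
  rw [div_le_iff₀ (by linarith), mul_assoc]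
  apply le_mul_of_one_le_right h0
  nlinarith

/-- Common source of the second and third claims, hence correction factors explicit in `n` and `u`.
-/
theorem exists_weighted_sum_le (G : ℕ) :
    ∃ (A : ℝ) (E : ℕ), 0 ≤ A ∧ ∀ (u : ℝ) (fl : ℝ → ℝ), IsRounding u fl →
      ∀ (n : ℕ) (b : ℕ → ℝ) (s : ℝ), s ∈ Set.Icc (0 : ℝ) 1 →
        ((3 * n + 5 * (G + 1) : ℕ) : ℝ) * u ≤ 1 / 2 →
        0 ≤ ∑ k ∈ Finset.range n, gamma u (3 * k + 5 * (G + 1)) * L fl n b s (G + 1) k ∧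
        ∑ k ∈ Finset.range n, gamma u (3 * k + 5 * (G + 1)) * L fl n b s (G + 1) k ≤
          (1 + 2 * (((3 * n + 5 * (G + 1) : ℕ) : ℝ) * u)) * (1 + u) ^ (3 * n + E) *
            ((3 ^ (G + 2) * (n.choose (G + 2) : ℝ) + A * (n : ℝ) ^ (G + 1)) * u ^ (G + 2)
              * pTilde n b s) := by
  obtain ⟨A, E, hA, hE⟩ := exists_errorSum_le G
  refine ⟨sumConst A G, E, sumConst_nonneg hA G, fun u fl h n b s hs hn => ?_⟩
  have hu := h.pos
  have hp := pTilde_nonneg n b hs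
  have heq : ∑ k ∈ Finset.range n, gamma u (3 * k + 5 * (G + 1)) * L fl n b s (G + 1) k =
      ∑ m ∈ Finset.range n, gamma u (3 * (n - (m + 1)) + 5 * (G + 1)) * errorSum fl n b s G m := by
    rw [← Finset.sum_range_reflect]
    refine Finset.sum_congr rfl fun m hm => ?_
    rw [show n - 1 - m = n - (m + 1) by omega, L_eq_errorSum fl (Finset.mem_range.mp hm)]
  rw [heq]
  set N := 3 * n + 5 * (G + 1) with hN
  have hle : ∀ m, 3 * (n - (m + 1)) + 5 * (G + 1) ≤ N := fun m => by omega
  have hg0 : ∀ m, 0 ≤ gamma u (3 * (n - (m + 1)) + 5 * (G + 1)) := fun m => by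
    refine gamma_nonneg hu.le (le_trans ?_ hn)
    have : ((3 * (n - (m + 1)) + 5 * (G + 1) : ℕ) : ℝ) ≤ N := by exact_mod_cast hle m
    exact mul_le_mul_of_nonneg_right this hu.le
  refine ⟨Finset.sum_nonneg fun m _ => mul_nonneg (hg0 m) (errorSum_nonneg fl n b hs G m), ?_⟩
  set Φ := (1 + 2 * ((N : ℝ) * u)) * (1 + u) ^ (3 * n + E) with hΦ
  have hΦ0 : 0 ≤ Φ := by positivity
  calc _ ≤ ∑ m ∈ Finset.range n, Φ * u ^ (G + 2) * pTilde n b s *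
        (((3 * (n - (m + 1)) + 5 * (G + 1) : ℕ) : ℝ) * coeff A G m) := by
        refine Finset.sum_le_sum fun m hm => ?_
        have hm' := Finset.mem_range.mp hm
        have hc := coeff_nonneg hA G m
        have h1 := gamma_le hu.le (hle m) hn
        have h2 := hE u fl h n b s hs m hm'
        have h3 : (1 + u) ^ (3 * (m + 1) + E) ≤ (1 + u) ^ (3 * n + E) :=
          pow_le_pow_right₀ (by linarith) (by omega)
        calc _ ≤ _ := mul_le_mul h1 h2 (errorSum_nonneg fl n b hs G m) (by positivity)
          _ ≤ (((3 * (n - (m + 1)) + 5 * (G + 1) : ℕ) : ℝ) * u) * (1 + 2 * (N * u)) *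
            ((1 + u) ^ (3 * n + E) * (u ^ (G + 1) * pTilde n b s) * coeff A G m) := by
            gcongr
          _ = _ := by rw [hΦ]; ring
    _ = Φ * u ^ (G + 2) * pTilde n b s * ∑ m ∈ Finset.range n,
        (((3 * (n - (m + 1)) + 5 * (G + 1) : ℕ) : ℝ) * coeff A G m) := by rw [Finset.mul_sum]
    _ ≤ Φ * u ^ (G + 2) * pTilde n b s *
        (3 ^ (G + 2) * (n.choose (G + 2) : ℝ) + sumConst A G * (n : ℝ) ^ (G + 1)) := by
        have := sum_weight_mul_coeff_le hA G n
        gcongr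
    _ = _ := by ring

/-! ### Expansion of the correction factors. -/

theorem exists_one_add_pow_le (M : ℕ) :
    ∃ C : ℝ, 0 ≤ C ∧ ∀ u : ℝ, 0 ≤ u → u ≤ 1 → (1 + u) ^ M ≤ 1 + C * u := by
  induction M with
  | zero => exact ⟨0, le_rfl, fun u _ _ => by simp⟩
  | succ M ih =>
    obtain ⟨C, hC, h⟩ := ih
    refine ⟨2 * C + 1, by linarith, fun u h0 h1 => ?_⟩
    have := mul_le_mul_of_nonneg_right (h u h0 h1) (by linarith : 0 ≤ 1 + u)
    have h3 : C * u * u ≤ C * u := mul_le_of_le_one_right (by positivity) h1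
    rw [pow_succ]
    linarith

theorem L_le (G : ℕ) : ∃ A : ℝ, ∀ k : ℕ, 1 ≤ k → ∃ C u₀ : ℝ, 0 < u₀ ∧
    ∀ (u : ℝ) (fl : ℝ → ℝ), IsRounding u fl → u ≤ u₀ →
    ∀ (n : ℕ) (b : ℕ → ℝ) (s : ℝ), k ≤ n → s ∈ Set.Icc (0 : ℝ) 1 →
      L fl n b s (G + 1) (n - k) ≤
        (((3 : ℝ) ^ (G + 1) * (k.choose G : ℝ) + A * (k : ℝ) ^ (((G + 1 : ℕ) : ℤ) - 2)) * u ^ (G + 1)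
          + C * u ^ (G + 2)) * pTilde n b s := by
  obtain ⟨A, E, hA, hE⟩ := exists_errorSum_le G
  refine ⟨A * G, fun k hk => ?_⟩
  obtain ⟨m, rfl⟩ := Nat.exists_eq_add_of_le' hk
  obtain ⟨C, hC, hpow⟩ := exists_one_add_pow_le (3 * (m + 1) + E)
  refine ⟨C * coeff A G m, 1, one_pos, fun u fl h hu1 n b s hn hs => ?_⟩
  have hu := h.pos
  have hp := pTilde_nonneg n b hs
  have hc := coeff_nonneg hA G m
  have hcoeff : (3 : ℝ) ^ (G + 1) * ((m + 1).choose G : ℝ)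
      + A * G * ((m + 1 : ℕ) : ℝ) ^ (((G + 1 : ℕ) : ℤ) - 2) = coeff A G m := by
    unfold coeff
    -- At `G = 0` the integer exponent is `-1`, but its coefficient `A * G` is zero.
    rcases G with _ | G
    · simp
    · rw [show (((G + 1 + 1 : ℕ) : ℤ) - 2) = (G : ℤ) by push_cast; ring, zpow_natCast,
        Nat.add_sub_cancel]
      push_cast
      rfl
  rw [L_eq_errorSum fl hn, hcoeff]
  calc _ ≤ _ := hE u fl h n b s hs m hn
    _ ≤ (1 + C * u) * (u ^ (G + 1) * pTilde n b s) * coeff A G m := by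
      have := hpow u hu.le hu1
      gcongr
    _ = _ := by ring

theorem weighted_sum_le (G : ℕ) : ∃ A : ℝ, ∀ n : ℕ, ∃ C u₀ : ℝ, 0 < u₀ ∧
    ∀ (u : ℝ) (fl : ℝ → ℝ), IsRounding u fl → u ≤ u₀ →
    ∀ (b : ℕ → ℝ) (s : ℝ), s ∈ Set.Icc (0 : ℝ) 1 →
      ∑ k ∈ Finset.range n, gamma u (3 * k + 5 * (G + 1)) * L fl n b s (G + 1) k ≤
        (((3 : ℝ) ^ (G + 2) * (n.choose (G + 2) : ℝ) + A * (n : ℝ) ^ (G + 1)) * u ^ (G + 2)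
          + C * u ^ (G + 3)) * pTilde n b s := by
  obtain ⟨A, E, hA, hE⟩ := exists_weighted_sum_le G
  refine ⟨A, fun n => ?_⟩
  obtain ⟨C, hC, hpow⟩ := exists_one_add_pow_le (3 * n + E)
  set N := 3 * n + 5 * (G + 1) with hN
  have hN0 : (0 : ℝ) < N := by rw [hN]; positivity
  set Q := (3 : ℝ) ^ (G + 2) * (n.choose (G + 2) : ℝ) + A * (n : ℝ) ^ (G + 1) with hQ
  have hQ0 : 0 ≤ Q := by positivity
  -- From `(1 + 2Nu)(1 + Cu)` with `u² ≤ u`; the threshold ensures `N u ≤ 1/2`.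
  refine ⟨(C + 2 * N * (1 + C)) * Q, 1 / (2 * N), by positivity, fun u fl h hu0 b s hs => ?_⟩
  have hu := h.pos
  have hp := pTilde_nonneg n b hs
  have hNu : (N : ℝ) * u ≤ 1 / 2 := by
    rw [le_div_iff₀ (by positivity)] at hu0
    linarith
  have hpow := hpow u hu.le h.lt_one.le
  have hΦ : (1 + 2 * ((N : ℝ) * u)) * (1 + u) ^ (3 * n + E) ≤ 1 + (C + 2 * N * (1 + C)) * u := by
    have h1 := mul_le_mul_of_nonneg_left hpow (by positivity : 0 ≤ 1 + 2 * ((N : ℝ) * u))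
    have h2 : 2 * N * C * u * u ≤ 2 * N * C * u :=
      mul_le_of_le_one_right (by positivity) h.lt_one.le
    linarith
  calc _ ≤ _ := (hE u fl h n b s hs hNu).2
    _ ≤ (1 + (C + 2 * N * (1 + C)) * u) * (Q * u ^ (G + 2) * pTilde n b s) := by gcongr
    _ = _ := by ring

theorem abs_weighted_sum_le (G : ℕ) : ∃ C δ : ℝ, 0 < δ ∧
    ∀ (u : ℝ) (fl : ℝ → ℝ), IsRounding u fl →
    ∀ (n : ℕ) (b : ℕ → ℝ) (s : ℝ), 3 * (n : ℝ) * u ≤ δ → s ∈ Set.Icc (0 : ℝ) 1 →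
      |∑ k ∈ Finset.range n, gamma u (3 * k + 5 * (G + 1)) * L fl n b s (G + 1) k| ≤
        C * (3 * (n : ℝ) * u) ^ (G + 2) * pTilde n b s := by
  obtain ⟨A, E, hA, hE⟩ := exists_weighted_sum_le G
  -- The factor 2 bounds `1 + 2Nu` and the exponential bounds `(1 + u)^(3n + E)`. The choice of `δ`
  -- works because `3n + 5(G+1) ≤ (5G + 8) n` for `n ≥ 1`.
  refine ⟨2 * Real.exp (3 + E) * (3 ^ (G + 2) + A), 1 / (2 * (5 * G + 8)), by positivity,
    fun u fl h n b s hδ hs => ?_⟩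
  have hu := h.pos
  have hp := pTilde_nonneg n b hs
  rcases Nat.eq_zero_or_pos n with rfl | hn
  · simp
  have hn1 : (1 : ℝ) ≤ n := by exact_mod_cast hn
  rw [le_div_iff₀ (by positivity)] at hδ
  have hun : 0 ≤ (n : ℝ) * u := by positivity
  have hG : (0 : ℝ) ≤ G := Nat.cast_nonneg G
  have hNu : ((3 * n + 5 * (G + 1) : ℕ) : ℝ) * u ≤ 1 / 2 := by
    have h1 : ((3 * n + 5 * (G + 1) : ℕ) : ℝ) ≤ (5 * G + 8) * n := by
      push_cast
      nlinarith
    have h2 := mul_le_mul_of_nonneg_right h1 hu.le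
    have h3 : 0 ≤ (5 * G + 8) * (n * u) := by positivity
    linarith
  have hnu1 : (n : ℝ) * u ≤ 1 := by
    have : 0 ≤ G * (n * u) := by positivity
    linarith
  obtain ⟨h0, h1⟩ := hE u fl h n b s hs hNu
  rw [abs_of_nonneg h0]
  have hexp : (1 + u) ^ (3 * n + E) ≤ Real.exp (3 + E) := by
    have e1 : 1 + u ≤ Real.exp u := by linarith [Real.add_one_le_exp u]
    calc _ ≤ Real.exp u ^ (3 * n + E) := by gcongr
      _ = Real.exp (((3 * n + E : ℕ) : ℝ) * u) := (Real.exp_nat_mul u _).symm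
      _ ≤ _ := by
        apply Real.exp_le_exp.mpr
        have e2 : u ≤ 1 := h.lt_one.le
        have e3 : (E : ℝ) * u ≤ E := mul_le_of_le_one_right (Nat.cast_nonneg _) e2
        push_cast
        linarith
  have hQ : (3 : ℝ) ^ (G + 2) * (n.choose (G + 2) : ℝ) + A * (n : ℝ) ^ (G + 1) ≤
      (3 ^ (G + 2) + A) * (3 * n) ^ (G + 2) := by
    have e1 := choose_le_pow_real n (G + 2)
    have e2 : (n : ℝ) ^ (G + 1) ≤ (n : ℝ) ^ (G + 2) := pow_le_pow_right₀ hn1 (by omega)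
    have e3 : (n : ℝ) ^ (G + 2) ≤ (3 * n) ^ (G + 2) := by gcongr; linarith
    calc _ ≤ (3 : ℝ) ^ (G + 2) * (3 * n) ^ (G + 2) + A * (3 * n) ^ (G + 2) := by
          gcongr
          · exact e1.trans e3
          · exact e2.trans e3
      _ = _ := by ring
  calc _ ≤ _ := h1
    _ ≤ 2 * Real.exp (3 + E) *
        (((3 ^ (G + 2) + A) * (3 * n) ^ (G + 2)) * u ^ (G + 2) * pTilde n b s) := by
      have : 1 + 2 * (((3 * n + 5 * (G + 1) : ℕ) : ℝ) * u) ≤ 2 := by linarith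
      gcongr
    _ = _ := by rw [mul_pow (3 * (n : ℝ)) u]; ring

end CompDC

theorem mainTheorem3 (F : ℕ) (hF : 1 ≤ F) :
    (∃ A : ℝ, ∀ k : ℕ, 1 ≤ k → ∃ C u₀ : ℝ, 0 < u₀ ∧
      ∀ (u : ℝ) (fl : ℝ → ℝ), CompDC.IsRounding u fl → u ≤ u₀ →
      ∀ (n : ℕ) (b : ℕ → ℝ) (s : ℝ), k ≤ n → s ∈ Set.Icc (0 : ℝ) 1 →
        CompDC.L fl n b s F (n - k) ≤
          (((3 : ℝ) ^ F * (k.choose (F - 1) : ℝ) + A * (k : ℝ) ^ ((F : ℤ) - 2)) * u ^ F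
            + C * u ^ (F + 1)) * CompDC.pTilde n b s) ∧
    (∃ A : ℝ, ∀ n : ℕ, ∃ C u₀ : ℝ, 0 < u₀ ∧
      ∀ (u : ℝ) (fl : ℝ → ℝ), CompDC.IsRounding u fl → u ≤ u₀ →
      ∀ (b : ℕ → ℝ) (s : ℝ), s ∈ Set.Icc (0 : ℝ) 1 →
        ∑ k ∈ Finset.range n, CompDC.gamma u (3 * k + 5 * F) * CompDC.L fl n b s F k ≤
          (((3 : ℝ) ^ (F + 1) * (n.choose (F + 1) : ℝ) + A * (n : ℝ) ^ F) * u ^ (F + 1)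
            + C * u ^ (F + 2)) * CompDC.pTilde n b s) ∧
    (∃ C δ : ℝ, 0 < δ ∧
      ∀ (u : ℝ) (fl : ℝ → ℝ), CompDC.IsRounding u fl →
      ∀ (n : ℕ) (b : ℕ → ℝ) (s : ℝ), 3 * (n : ℝ) * u ≤ δ → s ∈ Set.Icc (0 : ℝ) 1 →
        |∑ k ∈ Finset.range n, CompDC.gamma u (3 * k + 5 * F) * CompDC.L fl n b s F k| ≤
          C * (3 * (n : ℝ) * u) ^ (F + 1) * CompDC.pTilde n b s) := by
  obtain ⟨G, rfl⟩ := Nat.exists_eq_add_of_le' hF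
  exact ⟨CompDC.L_le G, CompDC.weighted_sum_le G, CompDC.abs_weighted_sum_le G⟩
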